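/- All graphs are finite, simple, undirected and connected. A graph is a cactus if every edge of it lies on at most one cycle. The augmented Zagreb index of a graph $G$ is $$AZI(G)=\sum_{uv\in E(G)}\left(\frac{d_u d_v}{d_u+d_v-2}\right)^3,$$ where $d_u$ denotes the degree of the vertex $u$. For integers $n\ge 4$ and $k\ge 0$ with $n\ge 2k+1$, let $G^0(n,k)$ be the graph obtained from the star $S_n$ on $n$ vertices by adding $k$ pairwise independent (that is, pairwise disjoint) edges between its pendent vertices (vertices of degree $1$). Let $G$ be a cactus with $n\ge 4$ vertices and exactly $k$ cycles (so that $n\ge 2k+1$). Then $$AZI(G)\ \ge\ (n-2k-1)\left(\frac{n-1}{n-2}\right)^3+24k,$$ with equality if and only if $G$ is isomorphic to $G^0(n,k)$. -/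

import Mathlib

namespace SimpleGraph

/-- The cycles of `G`, as subgraphs: those traced out by a closed walk that is a cycle.
Walks that differ only in starting point or direction give the same cycle. -/
def cycles {V : Type*} (G : SimpleGraph V) : Set G.Subgraph :=
  {C | ∃ (v : V) (p : G.Walk v v), p.IsCycle ∧ p.toSubgraph = C}

/-- A cactus: a connected graph in which every edge lies on at most one cycle. -/
structure IsCactus {V : Type*} (G : SimpleGraph V) : Prop where
  connected : G.Connected
  edge_mem_at_most_one : ∀ e ∈ G.edgeSet, ∀ C ∈ G.cycles, ∀ C' ∈ G.cycles,
    e ∈ C.edgeSet → e ∈ C'.edgeSet → C = C'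

/-- The augmented Zagreb index, the sum over the edges `uv` of
`(d u * d v / (d u + d v - 2)) ^ 3`, where `d` is the degree. -/
noncomputable def augmentedZagreb {V : Type*} [Fintype V] [DecidableEq V]
    (G : SimpleGraph V) [DecidableRel G.Adj] : ℝ :=
  ∑ e ∈ G.edgeFinset,
    Sym2.lift ⟨fun u v : V =>
      ((G.degree u : ℝ) * (G.degree v : ℝ) / ((G.degree u : ℝ) + (G.degree v : ℝ) - 2)) ^ 3,
      fun u v => by
        dsimp only
        rw [mul_comm (G.degree u : ℝ), add_comm (G.degree u : ℝ)]⟩ e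

/-- The graph obtained from the star on `n` vertices, with centre `0`, by adding the `k`
independent edges `{1, 2}, {3, 4}, …, {2k - 1, 2k}` between its pendent vertices.
It is meant for `2 * k + 1 ≤ n`; a cactus with `n` vertices and `k` cycles always satisfies this. -/
def starWithEdges (n k : ℕ) : SimpleGraph (Fin n) :=
  SimpleGraph.fromRel fun i j : Fin n =>
    (i : ℕ) = 0 ∨ ∃ t : ℕ, t < k ∧ (i : ℕ) = 2 * t + 1 ∧ (j : ℕ) = 2 * t + 2

end SimpleGraph

/-! Let `m` be the number of edges, `p` the number of pendant edges and `A = ((n-1)/(n-2))^3`. A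
pendant edge weighs at least `A` and any other edge at least 8, so the index is at least `pA +
8(m-p)`. This quantity equals `(n-2k-1)A + 24k + (8-A)(m-p-3k) + A(m-n-k+1)`. Both slack terms are
nonnegative, since `0 < A < 8`: `p + 3k ≤ m` because the cycles are edge-disjoint, have length at
least 3 and miss pendant edges (`IsCactus.card_pendantEdges_add_le`), and `n + k ≤ m + 1` by
counting edges off a spanning tree (`IsCactus.card_add_ncard_cycles_le`).

Both directions of the equality case pass through a universal vertex. Equality makes every edge
weight minimal and `m = p + 3k`, which yields such a vertex (`IsCactus.exists_isUniversal`). In a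
cactus the edges avoiding it form a matching with one edge per cycle, which determines the graph
(`IsCactus.nonempty_iso_starWithEdges`). Conversely, a universal vertex makes every estimate tight.
-/

namespace SimpleGraph

/-! ### Counting edges of a cactus through its cycles. -/

section Cycles

variable {V : Type*} {G : SimpleGraph V}

lemma exists_mem_cycles_of_triangle {a b c : V} (hab : G.Adj a b) (hbc : G.Adj b c)
    (hca : G.Adj c a) :
    ∃ C ∈ G.cycles, C.edgeSet = {s(a, b), s(b, c), s(c, a)} := by
  have h1 := hab.ne
  have h2 := hbc.ne
  have h3 := hca.ne
  refine ⟨_, ⟨a, .cons hab (.cons hbc (.cons hca .nil)), ?_, rfl⟩, ?_⟩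
  · rw [Walk.cons_isCycle_iff]
    simp [Walk.cons_isPath_iff, h1, h2, h3, h1.symm, h3.symm]
  · ext e
    rw [Walk.edgeSet_toSubgraph]
    simp [Walk.edgeSet]

lemma three_le_ncard_edgeSet_of_mem_cycles [Finite V] {C : G.Subgraph} (hC : C ∈ G.cycles) :
    3 ≤ C.edgeSet.ncard := by
  classical
  obtain ⟨v, p, hp, rfl⟩ := hC
  have h : (p.toSubgraph.edgeSet) = (p.edges.toFinset : Set (Sym2 V)) := by
    ext e; simp
  rw [h, Set.ncard_coe_finset, List.toFinset_card_of_nodup hp.edges_nodup, Walk.length_edges]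
  exact hp.three_le_length

lemma exists_adj_adj_of_mem_cycles_of_ncard_eq_three [Finite V] {C : G.Subgraph}
    (hC : C ∈ G.cycles) (h3 : C.edgeSet.ncard = 3) {x y : V} (hxy : s(x, y) ∈ C.edgeSet) :
    ∃ z, G.Adj x z ∧ G.Adj y z := by
  classical
  obtain ⟨v, p, hp, rfl⟩ := hC
  have h : (p.toSubgraph.edgeSet) = (p.edges.toFinset : Set (Sym2 V)) := by
    ext e; simp
  rw [h, Set.ncard_coe_finset, List.toFinset_card_of_nodup hp.edges_nodup,
    Walk.length_edges] at h3
  rw [Walk.mem_edges_toSubgraph] at hxy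
  match p, h3 with
  | .cons (v := b) hab (.cons (v := c) hbc (.cons hca .nil)), _ =>
    simp only [Walk.edges_cons, Walk.edges_nil, List.mem_cons, List.not_mem_nil, or_false,
      Sym2.eq_iff] at hxy
    rcases hxy with (⟨rfl, rfl⟩ | ⟨rfl, rfl⟩) | (⟨rfl, rfl⟩ | ⟨rfl, rfl⟩) |
      (⟨rfl, rfl⟩ | ⟨rfl, rfl⟩)
    · exact ⟨c, hca.symm, hbc⟩
    · exact ⟨c, hbc, hca.symm⟩
    · exact ⟨_, hab.symm, hca⟩
    · exact ⟨_, hca, hab.symm⟩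
    · exact ⟨b, hbc.symm, hab⟩
    · exact ⟨b, hab, hbc.symm⟩

lemma degree_ne_one_of_mem_cycles [Fintype V] [DecidableRel G.Adj] {C : G.Subgraph}
    (hC : C ∈ G.cycles) {e : Sym2 V} (he : e ∈ C.edgeSet) {v : V} (hv : v ∈ e) :
    G.degree v ≠ 1 := by
  classical
  obtain ⟨u, p, hp, rfl⟩ := hC
  rw [Walk.mem_edges_toSubgraph] at he
  obtain ⟨w, rfl⟩ := hv
  have h2 := hp.ncard_neighborSet_toSubgraph_eq_two (p.fst_mem_support_of_mem_edges he)
  have := Set.ncard_le_ncard (p.toSubgraph.neighborSet_subset v)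
  rw [h2, Set.ncard_eq_toFinset_card', ← neighborFinset_def, card_neighborFinset_eq_degree] at this
  omega

/-- Otherwise the closed walk would transfer to a cycle of `T`. -/
lemma exists_mem_edgeSet_notMem_of_mem_cycles {T : SimpleGraph V} (hT : T.IsAcyclic)
    {C : G.Subgraph} (hC : C ∈ G.cycles) : ∃ e ∈ C.edgeSet, e ∈ G.edgeSet ∧ e ∉ T.edgeSet := by
  obtain ⟨u, p, hp, rfl⟩ := hC
  by_contra! h
  exact hT _ (hp.transfer (H := T) fun e he =>
    h e (p.mem_edges_toSubgraph.2 he) (p.edges_subset_edgeSet he))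

/-- A cactus has at least as many edges outside a spanning tree as it has
cycles. -/
lemma IsCactus.card_add_ncard_cycles_le [Fintype V] [DecidableEq V] [DecidableRel G.Adj]
    (hG : G.IsCactus) : Fintype.card V + G.cycles.ncard ≤ G.edgeFinset.card + 1 := by
  classical
  obtain ⟨T, hle, hT⟩ := hG.connected.exists_isTree_le
  have hTc := hT.card_edgeFinset
  have : Nonempty (Sym2 V) := hG.connected.nonempty.map fun v => s(v, v)
  -- Sending each cycle to one of its edges off `T` is injective, since an edge lies on at most one
  -- cycle.
  choose! f hf hfG hfT using fun (C : G.Subgraph) (hC : C ∈ G.cycles) =>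
    exists_mem_edgeSet_notMem_of_mem_cycles hT.isAcyclic hC
  have h1 : G.cycles.ncard ≤ ((G.edgeFinset \ T.edgeFinset : Finset _) : Set (Sym2 V)).ncard := by
    refine Set.ncard_le_ncard_of_injOn f (fun C hC => ?_) fun C hC C' hC' h => ?_
    · simpa using ⟨hfG C hC, hfT C hC⟩
    · exact hG.edge_mem_at_most_one (f C) (hfG C hC) C hC C' hC' (hf C hC) (h ▸ hf C' hC')
  rw [Set.ncard_coe_finset, Finset.card_sdiff_of_subset (edgeFinset_mono hle)] at h1
  have := Finset.card_le_card (edgeFinset_mono hle)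
  omega

open Classical in
/-- The edges with an endpoint of degree one. -/
noncomputable def pendantEdges [Fintype V] (G : SimpleGraph V) [DecidableRel G.Adj] :
    Finset (Sym2 V) :=
  G.edgeFinset.filter fun e => ∃ v ∈ e, G.degree v = 1

lemma mem_pendantEdges [Fintype V] [DecidableRel G.Adj] {e : Sym2 V} :
    e ∈ G.pendantEdges ↔ e ∈ G.edgeSet ∧ ∃ v ∈ e, G.degree v = 1 := by
  simp [pendantEdges]

lemma pendantEdges_subset [Fintype V] [DecidableEq V] [DecidableRel G.Adj] :
    G.pendantEdges ⊆ G.edgeFinset := fun e he => by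
  simpa using (mem_pendantEdges.1 he).1

/-- The cycles of a cactus are edge-disjoint and avoid the pendant edges. In the extremal case
all cycles are triangles, and they cover the remaining edges. -/
lemma IsCactus.card_pendantEdges_add_le [Fintype V] [DecidableEq V] [DecidableRel G.Adj]
    (hG : G.IsCactus) :
    G.pendantEdges.card + 3 * G.cycles.ncard ≤ G.edgeFinset.card ∧
      (G.pendantEdges.card + 3 * G.cycles.ncard = G.edgeFinset.card →
        ∀ e ∈ G.edgeSet, e ∉ G.pendantEdges →
          ∃ C ∈ G.cycles, C.edgeSet.ncard = 3 ∧ e ∈ C.edgeSet) := by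
  classical
  set S := G.cycles.toFinset with hS
  have hSk : G.cycles.ncard = S.card := Set.ncard_eq_toFinset_card' _
  have hmem : ∀ C, C ∈ S ↔ C ∈ G.cycles := fun C => by simp [hS]
  have hcard : ∀ C : G.Subgraph, C.edgeSet.toFinset.card = C.edgeSet.ncard := fun C =>
    (Set.ncard_eq_toFinset_card' _).symm
  have hdisj : (S : Set G.Subgraph).PairwiseDisjoint fun C => C.edgeSet.toFinset := by
    intro C hC C' hC' hne
    rw [Function.onFun, Finset.disjoint_left]
    intro e he he'
    simp only [Set.mem_toFinset] at he he'
    exact hne (hG.edge_mem_at_most_one e (C.edgeSet_subset he) C ((hmem C).1 hC) C'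
      ((hmem C').1 hC') he he')
  have hU := Finset.card_biUnion (s := S) (t := fun C => C.edgeSet.toFinset) hdisj
  have hge : ∀ C ∈ S, 3 ≤ C.edgeSet.toFinset.card := fun C hC => by
    rw [hcard]; exact three_le_ncard_edgeSet_of_mem_cycles ((hmem C).1 hC)
  have hsum : ∑ _C ∈ S, 3 ≤ ∑ C ∈ S, C.edgeSet.toFinset.card := Finset.sum_le_sum hge
  have hPU : Disjoint G.pendantEdges (S.biUnion fun C => C.edgeSet.toFinset) := by
    rw [Finset.disjoint_left]
    intro e he he'
    obtain ⟨C, hC, heC⟩ := Finset.mem_biUnion.1 he'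
    obtain ⟨v, hv, hd⟩ := (mem_pendantEdges.1 he).2
    exact degree_ne_one_of_mem_cycles ((hmem C).1 hC) (Set.mem_toFinset.1 heC) hv hd
  have hsub : G.pendantEdges ∪ (S.biUnion fun C => C.edgeSet.toFinset) ⊆ G.edgeFinset := by
    refine Finset.union_subset pendantEdges_subset (Finset.biUnion_subset.2 fun C _ e he => ?_)
    simpa using C.edgeSet_subset (Set.mem_toFinset.1 he)
  have hle := Finset.card_le_card hsub
  rw [Finset.card_union_of_disjoint hPU, hU] at hle
  have h3 : ∑ _C ∈ S, 3 = 3 * G.cycles.ncard := by simp [hSk, mul_comm]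
  refine ⟨by omega, fun heq e he hep => ?_⟩
  -- Equality forces the pendant edges and the cycles to exhaust the edge set, and each cycle to
  -- have exactly 3 edges.
  have hE := Finset.eq_of_subset_of_card_le hsub
    (by rw [Finset.card_union_of_disjoint hPU, hU]; omega)
  have h3' := (Finset.sum_eq_sum_iff_of_le hge).1 (by omega)
  have he' : e ∈ G.edgeFinset := by simpa using he
  rw [← hE, Finset.mem_union, Finset.mem_biUnion] at he'
  obtain ⟨C, hC, heC⟩ := he'.resolve_left hep
  exact ⟨C, (hmem C).1 hC, by rw [← hcard, ← h3' C hC], Set.mem_toFinset.1 heC⟩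

/-- A vertex whose closed neighbourhood is closed under adjacency is universal. -/
lemma Connected.isUniversal_of_closed (hG : G.Connected) {c : V}
    (h : ∀ v w, G.Adj c v → G.Adj v w → w = c ∨ G.Adj c w) : G.IsUniversal c := by
  have key : ∀ w, G.Reachable c w → w = c ∨ G.Adj c w := by
    intro w hw
    rw [reachable_iff_reflTransGen] at hw
    induction hw with
    | refl => exact .inl rfl
    | tail _ hbc ih =>
      rcases ih with rfl | hb
      · exact .inr hbc
      · exact h _ _ hb hbc
  intro w hw
  exact (key w (hG.preconnected c w)).resolve_left hw.symm

end Cycles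

/-! ### Cacti with a universal vertex. -/

section Universal

variable {V : Type*} {G : SimpleGraph V}

/-- In a cactus, a vertex has at most one neighbour besides a universal vertex. -/
lemma IsCactus.eq_of_adj_of_isUniversal (hG : G.IsCactus) {c : V} (hc : G.IsUniversal c)
    {v a b : V} (hv : v ≠ c) (ha : a ≠ c) (hb : b ≠ c) (hva : G.Adj v a) (hvb : G.Adj v b) :
    a = b := by
  obtain ⟨C, hC, hCe⟩ := exists_mem_cycles_of_triangle (hc hv.symm) hva (hc ha.symm).symm
  obtain ⟨D, hD, hDe⟩ := exists_mem_cycles_of_triangle (hc hv.symm) hvb (hc hb.symm).symm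
  have hCD := hG.edge_mem_at_most_one s(c, v) (hc hv.symm) C hC D hD (by simp [hCe])
    (by simp [hDe])
  have h : s(v, a) ∈ D.edgeSet := by rw [← hCD, hCe]; simp
  rw [hDe] at h
  simp only [Set.mem_insert_iff, Set.mem_singleton_iff, Sym2.eq_iff] at h
  have := hva.ne
  grind

lemma IsCactus.degree_le_two_of_isUniversal [Fintype V] [DecidableEq V] [DecidableRel G.Adj]
    (hG : G.IsCactus) {c : V} (hc : G.IsUniversal c) {v : V} (hv : v ≠ c) : G.degree v ≤ 2 := by
  by_cases h : ∃ a, a ≠ c ∧ G.Adj v a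
  · obtain ⟨a, ha, hva⟩ := h
    have : G.neighborFinset v ⊆ {c, a} := fun b hb => by
      rw [mem_neighborFinset] at hb
      by_cases hbc : b = c
      · simp [hbc]
      · simp [hG.eq_of_adj_of_isUniversal hc hv hbc ha hb hva]
    exact (Finset.card_le_card this).trans Finset.card_le_two
  · push Not at h
    have : G.neighborFinset v ⊆ {c} := fun b hb => by
      rw [mem_neighborFinset] at hb
      by_contra hbc
      exact h b (by simpa using hbc) hb
    exact (Finset.card_le_card this).trans (by simp)

lemma IsUniversal.degree_eq [Fintype V] [DecidableRel G.Adj] {c : V}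
    (hc : G.IsUniversal c) : G.degree c = Fintype.card V - 1 := by
  classical
  have : G.neighborFinset c = Finset.univ.erase c := by
    ext v
    simp only [mem_neighborFinset, Finset.mem_erase, Finset.mem_univ, and_true]
    exact ⟨fun h => h.ne', fun h => hc h.symm⟩
  rw [← card_neighborFinset_eq_degree, this, Finset.card_erase_of_mem (Finset.mem_univ c),
    Finset.card_univ]

lemma isUniversal_of_degree_eq [Fintype V] [DecidableRel G.Adj] {c : V}
    (h : G.degree c = Fintype.card V - 1) : G.IsUniversal c := by
  classical
  intro w hw
  have hsub : G.neighborFinset c ⊆ Finset.univ.erase c := fun v hv => by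
    rw [mem_neighborFinset] at hv
    simpa using hv.ne'
  have := Finset.eq_of_subset_of_card_le hsub (by
    rw [Finset.card_erase_of_mem (Finset.mem_univ c), Finset.card_univ,
      card_neighborFinset_eq_degree, h])
  rw [← mem_neighborFinset, this]
  simpa using hw.symm

/-- The edges avoiding a vertex `c`. -/
def edgesAvoiding [Fintype V] [DecidableEq V] (G : SimpleGraph V) [DecidableRel G.Adj] (c : V) :
    Finset (Sym2 V) :=
  G.edgeFinset.filter fun e => c ∉ e

lemma mem_edgesAvoiding [Fintype V] [DecidableEq V] [DecidableRel G.Adj] {c : V} {e : Sym2 V} :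
    e ∈ G.edgesAvoiding c ↔ e ∈ G.edgeSet ∧ c ∉ e := by
  simp [edgesAvoiding]

lemma card_edgesAvoiding_add_degree [Fintype V] [DecidableEq V] [DecidableRel G.Adj] (c : V) :
    (G.edgesAvoiding c).card + G.degree c = G.edgeFinset.card := by
  rw [← card_incidenceFinset_eq_degree, incidenceFinset_eq_filter, edgesAvoiding, add_comm,
    Finset.card_filter_add_card_filter_not]

lemma IsUniversal.exists_triangle {c : V} (hc : G.IsUniversal c) {e : Sym2 V}
    (he : e ∈ G.edgeSet) (hce : c ∉ e) :
    ∃ C ∈ G.cycles, e ∈ C.edgeSet ∧ ∀ f ∈ C.edgeSet, c ∉ f → f = e := by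
  induction e with
  | h a b =>
    simp only [Sym2.mem_iff, not_or] at hce
    obtain ⟨C, hC, hCe⟩ := exists_mem_cycles_of_triangle he (hc hce.2).symm (hc hce.1)
    refine ⟨C, hC, by simp [hCe], fun f hf hcf => ?_⟩
    rw [hCe] at hf
    rcases hf with rfl | rfl | rfl
    · rfl
    · simp at hcf
    · simp at hcf

/-- Each edge avoiding `c` spans a triangle with `c` and is the only edge of that triangle avoiding
`c`, so distinct edges give distinct cycles. -/
lemma IsUniversal.card_edgesAvoiding_le [Fintype V] [DecidableEq V] [DecidableRel G.Adj] {c : V}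
    (hc : G.IsUniversal c) : (G.edgesAvoiding c).card ≤ G.cycles.ncard := by
  choose! f hf hef hfe using fun (e : Sym2 V) (h : e ∈ G.edgeSet ∧ c ∉ e) =>
    hc.exists_triangle h.1 h.2
  rw [← Set.ncard_coe_finset]
  refine Set.ncard_le_ncard_of_injOn f (fun e he => hf e (mem_edgesAvoiding.1 he))
    fun e he e' he' h => ?_
  have h1 := mem_edgesAvoiding.1 he
  have h2 := mem_edgesAvoiding.1 he'
  exact hfe e' h2 e (h ▸ hef e h1) h1.2

/-- The triangles through `c` give one inequality. The spanning tree count gives the other, as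
exactly `n - 1` edges meet `c`. -/
lemma IsCactus.card_edgesAvoiding_eq [Fintype V] [DecidableEq V] [DecidableRel G.Adj]
    (hG : G.IsCactus) {c : V} (hc : G.IsUniversal c) :
    (G.edgesAvoiding c).card = G.cycles.ncard := by
  have h1 := hc.card_edgesAvoiding_le
  have h2 := hG.card_add_ncard_cycles_le
  have h3 := G.card_edgesAvoiding_add_degree c
  have h4 := hc.degree_eq
  have : 0 < Fintype.card V := Fintype.card_pos_iff.2 ⟨c⟩
  omega

/-- A vertex other than `c` that is on no edge avoiding `c` has `c` as its only neighbour; the edges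
avoiding `c` cover at most two vertices each. -/
lemma IsUniversal.card_le_card_pendantEdges [Fintype V] [DecidableEq V] [DecidableRel G.Adj]
    {c : V} (hc : G.IsUniversal c) :
    Fintype.card V ≤ G.pendantEdges.card + 2 * (G.edgesAvoiding c).card + 1 := by
  set U := (G.edgesAvoiding c).biUnion Sym2.toFinset
  have hU : U.card ≤ (G.edgesAvoiding c).card * 2 :=
    Finset.card_biUnion_le_card_mul _ _ _ fun e _ => by
      rw [Sym2.card_toFinset]; split_ifs <;> omega
  have hD : ((Finset.univ.erase c) \ U).card ≤ G.pendantEdges.card := by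
    refine Finset.card_le_card_of_injOn (fun v => s(c, v)) (fun v hv => ?_) fun v _ w _ h => ?_
    · simp only [Finset.coe_sdiff, Set.mem_sdiff, Finset.mem_coe, Finset.mem_erase,
        Finset.mem_univ, and_true] at hv
      refine mem_pendantEdges.2 ⟨hc hv.1.symm, v, by simp, ?_⟩
      have : G.neighborFinset v = {c} := by
        ext w
        simp only [mem_neighborFinset, Finset.mem_singleton]
        refine ⟨fun hw => ?_, fun hw => hw ▸ (hc hv.1.symm).symm⟩
        by_contra hwc
        refine hv.2 (Finset.mem_biUnion.2 ⟨s(v, w), mem_edgesAvoiding.2 ⟨hw, ?_⟩, by simp⟩)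
        simp [hv.1.symm, Ne.symm hwc]
      rw [← card_neighborFinset_eq_degree, this, Finset.card_singleton]
    · exact Sym2.congr_right.1 h
  have h1 := Finset.le_card_sdiff U (Finset.univ.erase c)
  rw [Finset.card_erase_of_mem (Finset.mem_univ c), Finset.card_univ] at h1
  omega

end Universal

/-! ### The isomorphism with the extremal graph. -/

section Star

variable {V : Type*} {G : SimpleGraph V}

lemma starWithEdges_isUniversal {n k : ℕ} (c : Fin n) (hc : (c : ℕ) = 0) :
    (starWithEdges n k).IsUniversal c := fun w hw => by
  rw [starWithEdges, fromRel_adj]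
  exact ⟨hw, .inl (.inl hc)⟩

lemma IsUniversal.of_iso {W : Type*} {H : SimpleGraph W} {c : W} (hc : H.IsUniversal c)
    (f : G ≃g H) : G.IsUniversal (f.symm c) := fun w hw => by
  have := hc (w := f w) fun h => hw (by simp [h])
  rw [← f.map_adj_iff]
  simpa using this

/-- A cactus with a universal vertex is a star with independent edges between pendent vertices. -/
lemma IsCactus.nonempty_iso_starWithEdges [Fintype V] [DecidableEq V] [DecidableRel G.Adj]
    (hG : G.IsCactus) {c : V} (hc : G.IsUniversal c) :
    Nonempty (G ≃g starWithEdges (Fintype.card V) G.cycles.ncard) := by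
  set n := Fintype.card V with hn
  set k := G.cycles.ncard with hk
  have hQ : (G.edgesAvoiding c).card = k := hG.card_edgesAvoiding_eq hc
  let q := Finset.equivFinOfCardEq hQ
  -- Orient the `t`-th edge avoiding `c`; the value for `t ≥ k` is irrelevant.
  have hex : ∀ t : ℕ, ∃ p : V × V, ∀ h : t < k, (q.symm ⟨t, h⟩ : Sym2 V) = s(p.1, p.2) := by
    intro t
    by_cases h : t < k
    · obtain ⟨a, b, hab⟩ : ∃ a b, (q.symm ⟨t, h⟩ : Sym2 V) = s(a, b) := by
        induction (q.symm ⟨t, h⟩ : Sym2 V) with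
        | h a b => exact ⟨a, b, rfl⟩
      exact ⟨(a, b), fun _ => hab⟩
    · exact ⟨(c, c), fun h' => absurd h' h⟩
  choose p hp using hex
  have hpQ : ∀ t < k, G.Adj (p t).1 (p t).2 ∧ (p t).1 ≠ c ∧ (p t).2 ≠ c := by
    intro t ht
    have := mem_edgesAvoiding.1 (q.symm ⟨t, ht⟩).2
    rw [hp t ht] at this
    simp only [mem_edgeSet, Sym2.mem_iff, not_or] at this
    exact ⟨this.1, Ne.symm this.2.1, Ne.symm this.2.2⟩
  have hpinj : ∀ t < k, ∀ t' < k, s((p t).1, (p t).2) = s((p t').1, (p t').2) → t = t' := by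
    intro t ht t' ht' h
    rw [← hp t ht, ← hp t' ht'] at h
    simpa using h
  have hpsurj : ∀ a b, G.Adj a b → a ≠ c → b ≠ c → ∃ t < k, s(a, b) = s((p t).1, (p t).2) := by
    intro a b hab ha hb
    have hm : s(a, b) ∈ G.edgesAvoiding c :=
      mem_edgesAvoiding.2 ⟨hab, by simp [ha.symm, hb.symm]⟩
    exact ⟨q ⟨_, hm⟩, (q ⟨_, hm⟩).2, by rw [← hp _ (q ⟨_, hm⟩).2]; simp⟩
  -- The edges avoiding `c` form a matching.
  have hmeet : ∀ t < k, ∀ t' < k, ∀ v, v ∈ s((p t).1, (p t).2) → v ∈ s((p t').1, (p t').2) →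
      t = t' := by
    intro t ht t' ht' v hv hv'
    obtain ⟨h1, h2, h3⟩ := hpQ t ht
    obtain ⟨h1', h2', h3'⟩ := hpQ t' ht'
    have key : ∀ v a b : V, v ≠ c → a ≠ c → b ≠ c → G.Adj v a → G.Adj v b → a = b :=
      fun v a b => hG.eq_of_adj_of_isUniversal hc
    refine hpinj t ht t' ht' ?_
    rw [Sym2.mem_iff] at hv hv'
    rw [Sym2.eq_iff]
    rcases hv with rfl | rfl <;> rcases hv' with h | h
    · exact .inl ⟨h, key _ _ _ h2 h3 h3' h1 (h ▸ h1')⟩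
    · exact .inr ⟨h, key _ _ _ h2 h3 h2' h1 (h ▸ h1'.symm)⟩
    · exact .inr ⟨key _ _ _ h3 h2 h3' h1.symm (h ▸ h1'), h⟩
    · exact .inl ⟨key _ _ _ h3 h2 h2' h1.symm (h ▸ h1'.symm), h⟩
  let f : Fin n → V := fun i =>
    if (i : ℕ) = 0 then c else if (i : ℕ) % 2 = 1 then (p ((i : ℕ) / 2)).1
      else (p (((i : ℕ) - 1) / 2)).2
  have hf0 : ∀ i : Fin n, (i : ℕ) = 0 → f i = c := fun i hi => by simp [f, hi]
  have hf1 : ∀ (i : Fin n) (t : ℕ), (i : ℕ) = 2 * t + 1 → f i = (p t).1 := fun i t hi => by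
    simp only [f]
    rw [if_neg (by omega), if_pos (by omega), show (i : ℕ) / 2 = t by omega]
  have hf2 : ∀ (i : Fin n) (t : ℕ), (i : ℕ) = 2 * t + 2 → f i = (p t).2 := fun i t hi => by
    simp only [f]
    rw [if_neg (by omega), if_neg (by omega), show ((i : ℕ) - 1) / 2 = t by omega]
  have hcases : ∀ i : Fin n, (i : ℕ) ≤ 2 * k →
      (i : ℕ) = 0 ∨ ∃ t < k, (i : ℕ) = 2 * t + 1 ∨ (i : ℕ) = 2 * t + 2 := by
    intro i hi
    by_cases h0 : (i : ℕ) = 0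
    · exact .inl h0
    · exact .inr ⟨((i : ℕ) - 1) / 2, by omega, by omega⟩
  have hinj : Set.InjOn f ((Finset.univ.filter fun i : Fin n => (i : ℕ) ≤ 2 * k) :
      Finset (Fin n)) := by
    intro i hi j hj hij
    simp only [Finset.coe_filter, Finset.mem_univ, true_and, Set.mem_ofPred_eq] at hi hj
    apply Fin.ext
    rcases hcases i hi with h | ⟨t, ht, h | h⟩ <;> rcases hcases j hj with h' | ⟨t', ht', h' | h'⟩
    · omega
    · rw [hf0 i h, hf1 j t' h'] at hij
      exact absurd hij.symm (hpQ t' ht').2.1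
    · rw [hf0 i h, hf2 j t' h'] at hij
      exact absurd hij.symm (hpQ t' ht').2.2
    · rw [hf0 j h', hf1 i t h] at hij
      exact absurd hij (hpQ t ht).2.1
    · rw [hf1 i t h, hf1 j t' h'] at hij
      have := hmeet t ht t' ht' (p t).1 (by simp) (by simp [hij])
      omega
    · rw [hf1 i t h, hf2 j t' h'] at hij
      obtain rfl := hmeet t ht t' ht' (p t).1 (by simp) (by simp [hij])
      exact absurd hij (hpQ t ht).1.ne
    · rw [hf0 j h', hf2 i t h] at hij
      exact absurd hij (hpQ t ht).2.2
    · rw [hf2 i t h, hf1 j t' h'] at hij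
      obtain rfl := hmeet t ht t' ht' (p t).2 (by simp) (by simp [hij])
      exact absurd hij (hpQ t ht).1.ne'
    · rw [hf2 i t h, hf2 j t' h'] at hij
      have := hmeet t ht t' ht' (p t).2 (by simp) (by simp [hij])
      omega
  have hnk : 2 * k + 1 ≤ n := by
    have h1 := hG.card_add_ncard_cycles_le
    have h2 := hG.card_pendantEdges_add_le.1
    have h3 := G.card_edgesAvoiding_add_degree c
    have h4 := hc.degree_eq
    have : 0 < Fintype.card V := Fintype.card_pos_iff.2 ⟨c⟩
    omega
  -- Only the labels up to `2k` matter. The remaining vertices are adjacent to `c` alone, so any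
  -- bijective extension works.
  obtain ⟨g, hg⟩ := Finset.exists_equiv_extend_of_card_eq (α := Fin n) (t := (Finset.univ : Finset V))
    (by simp [hn]) (Finset.subset_univ _) hinj
  let g' : Fin n ≃ V := g.trans (Equiv.subtypeUnivEquiv Finset.mem_univ)
  have hg' : ∀ i : Fin n, (i : ℕ) ≤ 2 * k → g' i = f i := fun i hi => hg i (by simp [hi])
  have hgc : ∀ i : Fin n, g' i = c ↔ (i : ℕ) = 0 := by
    intro i
    have h0 : g' ⟨0, by omega⟩ = c := by rw [hg' _ (by simp), hf0 _ rfl]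
    rw [← h0, g'.injective.eq_iff, Fin.ext_iff]
  have hg1 : ∀ (i : Fin n) (t : ℕ), t < k → ((i : ℕ) = 2 * t + 1 ↔ g' i = (p t).1) := by
    intro i t ht
    have h0 : g' ⟨2 * t + 1, by omega⟩ = (p t).1 := by
      rw [hg' _ (by simp only; omega), hf1 _ t rfl]
    rw [← h0, g'.injective.eq_iff, Fin.ext_iff]
  have hg2 : ∀ (i : Fin n) (t : ℕ), t < k → ((i : ℕ) = 2 * t + 2 ↔ g' i = (p t).2) := by
    intro i t ht
    have h0 : g' ⟨2 * t + 2, by omega⟩ = (p t).2 := by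
      rw [hg' _ (by simp only; omega), hf2 _ t rfl]
    rw [← h0, g'.injective.eq_iff, Fin.ext_iff]
  have hadj : ∀ i j : Fin n, ((i : ℕ) = 0 ∨ ∃ t : ℕ, t < k ∧ (i : ℕ) = 2 * t + 1 ∧
      (j : ℕ) = 2 * t + 2) → i ≠ j → G.Adj (g' i) (g' j) := by
    rintro i j (h | ⟨t, ht, hi, hj⟩) hij
    · have hi := (hgc i).2 h
      have := hc (w := g' j) fun h' => hij (g'.injective (hi.trans h'))
      rwa [hi]
    · rw [(hg1 i t ht).1 hi, (hg2 j t ht).1 hj]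
      exact (hpQ t ht).1
  refine ⟨RelIso.symm ⟨g', ?_⟩⟩
  intro i j
  rw [starWithEdges, fromRel_adj]
  refine ⟨fun h => ⟨fun hij => h.ne (by rw [hij]), ?_⟩, ?_⟩
  · by_cases hi : g' i = c
    · exact .inl (.inl ((hgc i).1 hi))
    by_cases hj : g' j = c
    · exact .inr (.inl ((hgc j).1 hj))
    obtain ⟨t, ht, hs⟩ := hpsurj _ _ h hi hj
    rw [Sym2.eq_iff] at hs
    rcases hs with ⟨h1, h2⟩ | ⟨h1, h2⟩
    · exact .inl (.inr ⟨t, ht, (hg1 i t ht).2 h1, (hg2 j t ht).2 h2⟩)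
    · exact .inr (.inr ⟨t, ht, (hg1 j t ht).2 h2, (hg2 i t ht).2 h1⟩)
  · rintro ⟨hij, h | h⟩
    · exact hadj i j h hij
    · exact (hadj j i h hij.symm).symm

end Star

end SimpleGraph
namespace SimpleGraph

/-! ### Estimates for a single edge weight. -/

section Weight

/-- The contribution of an edge to the augmented Zagreb index. -/
noncomputable def zagrebWeight (x y : ℝ) : ℝ := (x * y / (x + y - 2)) ^ 3

lemma zagrebWeight_comm (x y : ℝ) : zagrebWeight x y = zagrebWeight y x := by
  rw [zagrebWeight, zagrebWeight, mul_comm, add_comm]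

lemma zagrebWeight_one_left (y : ℝ) : zagrebWeight 1 y = (y / (y - 1)) ^ 3 := by
  rw [zagrebWeight, one_mul, show 1 + y - 2 = y - 1 by ring]

/-- `d / (d - 1)` is strictly decreasing in `d`. -/
lemma le_zagrebWeight_one {n d : ℝ} (hd : 2 ≤ d) (hdn : d ≤ n - 1) :
    ((n - 1) / (n - 2)) ^ 3 ≤ zagrebWeight 1 d ∧
      (zagrebWeight 1 d = ((n - 1) / (n - 2)) ^ 3 → d = n - 1) := by
  have hd1 : 0 < d - 1 := by linarith
  have hn2 : 0 < n - 2 := by linarith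
  have h0 : 0 ≤ (n - 1) / (n - 2) := div_nonneg (by linarith) hn2.le
  rw [zagrebWeight_one_left]
  constructor
  · refine pow_le_pow_left₀ h0 ?_ 3
    rw [div_le_div_iff₀ hn2 hd1]
    nlinarith
  · intro h
    rw [pow_left_inj₀ (div_nonneg (by linarith) hd1.le) h0 (by norm_num),
      div_eq_div_iff hd1.ne' hn2.ne'] at h
    linarith

/-- `xy - 2(x + y - 2) = (x - 2)(y - 2)`. -/
lemma eight_le_zagrebWeight {x y : ℝ} (hx : 2 ≤ x) (hy : 2 ≤ y) :
    8 ≤ zagrebWeight x y ∧ (zagrebWeight x y = 8 ↔ x = 2 ∨ y = 2) := by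
  have hd : 0 < x + y - 2 := by linarith
  have h8 : (8 : ℝ) = 2 ^ 3 := by norm_num
  have h0 : 0 ≤ x * y / (x + y - 2) := by positivity
  rw [zagrebWeight, h8, pow_left_inj₀ h0 (by norm_num) (by norm_num)]
  refine ⟨pow_le_pow_left₀ (by norm_num) ?_ 3, ?_⟩
  · rw [le_div_iff₀ hd]
    nlinarith [mul_nonneg (sub_nonneg.2 hx) (sub_nonneg.2 hy)]
  · rw [div_eq_iff hd.ne', ← sub_eq_zero (a := x), ← sub_eq_zero (a := y), ← mul_eq_zero]
    constructor <;> intro h <;> linarith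

lemma star_weight_bounds {n : ℝ} (hn : 4 ≤ n) :
    0 < ((n - 1) / (n - 2)) ^ 3 ∧ ((n - 1) / (n - 2)) ^ 3 < 8 := by
  have hn2 : 0 < n - 2 := by linarith
  have h0 : 0 < (n - 1) / (n - 2) := div_pos (by linarith) hn2
  refine ⟨by positivity, ?_⟩
  rw [show (8 : ℝ) = 2 ^ 3 by norm_num]
  refine pow_lt_pow_left₀ ?_ h0.le (by norm_num)
  rw [div_lt_iff₀ hn2]
  linarith

end Weight

/-! ### Summing the edge bounds, and when they are tight. -/

section Bound

variable {V : Type*} [Fintype V] {G : SimpleGraph V} [DecidableRel G.Adj]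

/-- The contribution of an edge to the augmented Zagreb index. -/
noncomputable def edgeWeight (G : SimpleGraph V) [DecidableRel G.Adj] (e : Sym2 V) : ℝ :=
  Sym2.lift ⟨fun u v : V => zagrebWeight (G.degree u) (G.degree v),
    fun _ _ => zagrebWeight_comm _ _⟩ e

lemma edgeWeight_mk (u v : V) :
    G.edgeWeight s(u, v) = zagrebWeight (G.degree u) (G.degree v) := rfl

lemma Connected.one_le_degree (hG : G.Connected) (hV : 2 ≤ Fintype.card V) (v : V) :
    1 ≤ G.degree v := by
  have : Nontrivial V := Fintype.one_lt_card_iff_nontrivial.1 hV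
  exact hG.preconnected.degree_pos_of_nontrivial v

lemma eq_of_adj_of_degree_eq_one {v a b : V} (h : G.degree v = 1) (ha : G.Adj v a)
    (hb : G.Adj v b) : a = b := by
  rw [← card_neighborFinset_eq_degree, Finset.card_eq_one] at h
  obtain ⟨w, hw⟩ := h
  have h1 : a ∈ G.neighborFinset v := by simpa using ha
  have h2 : b ∈ G.neighborFinset v := by simpa using hb
  rw [hw, Finset.mem_singleton] at h1 h2
  rw [h1, h2]

variable [DecidableEq V]

lemma augmentedZagreb_eq_sum : G.augmentedZagreb = ∑ e ∈ G.edgeFinset, G.edgeWeight e := rfl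

/-- In a connected graph on at least three vertices, two vertices of degree one are not
adjacent. -/
lemma Connected.two_le_degree_of_adj (hG : G.Connected) (hV : 3 ≤ Fintype.card V) {u v : V}
    (huv : G.Adj u v) (hu : G.degree u = 1) : 2 ≤ G.degree v := by
  by_contra hlt
  have hv : G.degree v = 1 := by
    have := hG.one_le_degree (by omega) v
    omega
  -- Two adjacent vertices of degree one would form a whole component, making `u` universal of
  -- degree at least 2.
  have hU : G.IsUniversal u := hG.isUniversal_of_closed fun a b ha hb => by
    rw [← eq_of_adj_of_degree_eq_one hu huv ha] at hb
    exact .inl (eq_of_adj_of_degree_eq_one hv hb huv.symm)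
  have := hU.degree_eq
  omega

lemma Connected.exists_eq_mk_of_mem_pendantEdges (hG : G.Connected) (hV : 3 ≤ Fintype.card V)
    {e : Sym2 V} (he : e ∈ G.pendantEdges) :
    ∃ u v, e = s(u, v) ∧ G.Adj u v ∧ G.edgeWeight e = zagrebWeight 1 (G.degree v) ∧
      (2 : ℝ) ≤ G.degree v ∧ (G.degree v : ℝ) ≤ Fintype.card V - 1 := by
  obtain ⟨heG, u, ⟨v, rfl⟩, hu⟩ := mem_pendantEdges.1 he
  refine ⟨u, v, rfl, heG, by rw [edgeWeight_mk, hu, Nat.cast_one], ?_, ?_⟩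
  · exact_mod_cast hG.two_le_degree_of_adj hV heG hu
  · have := G.degree_lt_card_verts v
    have : ((G.degree v + 1 : ℕ) : ℝ) ≤ Fintype.card V := by exact_mod_cast this
    push_cast at this
    linarith

lemma Connected.two_le_degree_of_notMem_pendantEdges (hG : G.Connected)
    (hV : 3 ≤ Fintype.card V) {e : Sym2 V} (heG : e ∈ G.edgeSet) (he : e ∉ G.pendantEdges)
    {v : V} (hv : v ∈ e) : 2 ≤ G.degree v := by
  have h1 := hG.one_le_degree (by omega) v
  have h2 : G.degree v ≠ 1 := fun h => he (mem_pendantEdges.2 ⟨heG, v, hv, h⟩)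
  omega

open Classical in
/-- A lower bound for the weight of an edge. -/
noncomputable def edgeBound (G : SimpleGraph V) [DecidableRel G.Adj] (e : Sym2 V) : ℝ :=
  if e ∈ G.pendantEdges then
    (((Fintype.card V : ℝ) - 1) / ((Fintype.card V : ℝ) - 2)) ^ 3 else 8

lemma Connected.edgeBound_le (hG : G.Connected) (hV : 3 ≤ Fintype.card V) :
    ∀ e ∈ G.edgeFinset, G.edgeBound e ≤ G.edgeWeight e := by
  intro e he
  by_cases h : e ∈ G.pendantEdges
  · obtain ⟨u, v, -, -, hw, h2, hn⟩ := hG.exists_eq_mk_of_mem_pendantEdges hV h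
    rw [edgeBound, if_pos h, hw]
    exact (le_zagrebWeight_one h2 hn).1
  · rw [edgeBound, if_neg h]
    have key := fun v hv =>
      hG.two_le_degree_of_notMem_pendantEdges (v := v) hV (by simpa using he) h hv
    induction e with
    | h u v =>
      exact (eight_le_zagrebWeight (by exact_mod_cast key u (by simp))
        (by exact_mod_cast key v (by simp))).1

lemma sum_edgeBound : ∑ e ∈ G.edgeFinset, G.edgeBound e =
    G.pendantEdges.card * (((Fintype.card V : ℝ) - 1) / ((Fintype.card V : ℝ) - 2)) ^ 3 +
      ((G.edgeFinset.card : ℝ) - G.pendantEdges.card) * 8 := by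
  have hsub : G.pendantEdges ⊆ G.edgeFinset := pendantEdges_subset
  rw [← Finset.sum_sdiff hsub, add_comm]
  congr 1
  · rw [Finset.sum_congr rfl fun e he => show G.edgeBound e = _ from if_pos he]
    simp
  · rw [Finset.sum_congr rfl fun e he =>
      show G.edgeBound e = _ from if_neg (Finset.mem_sdiff.1 he).2]
    simp [Finset.card_sdiff_of_subset hsub, Nat.cast_sub (Finset.card_le_card hsub)]

/-- A cactus in which every edge is tight, and every non-pendant edge lies in a triangle,
has a universal vertex. -/
lemma IsCactus.exists_isUniversal (hG : G.IsCactus) (hV : 4 ≤ Fintype.card V)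
    (heq : G.pendantEdges.card + 3 * G.cycles.ncard = G.edgeFinset.card)
    (htight : ∀ e ∈ G.edgeFinset, G.edgeBound e = G.edgeWeight e) :
    ∃ c, G.IsUniversal c := by
  by_cases hP : ∃ e, e ∈ G.pendantEdges
  · obtain ⟨e, he⟩ := hP
    obtain ⟨u, v, -, -, hw, h2, hn⟩ :=
      hG.connected.exists_eq_mk_of_mem_pendantEdges (by omega) he
    have ht := htight e (pendantEdges_subset he)
    rw [edgeBound, if_pos he, hw] at ht
    have hd := (le_zagrebWeight_one h2 hn).2 ht.symm
    refine ⟨v, isUniversal_of_degree_eq ?_⟩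
    have : ((G.degree v + 1 : ℕ) : ℝ) = Fintype.card V := by push_cast; linarith
    have : G.degree v + 1 = Fintype.card V := by exact_mod_cast this
    omega
  · push Not at hP
    have := hG.connected.nonempty
    -- With no pendant edges, tightness gives every edge an end of degree 2. By maximality of `c`,
    -- all its neighbours then have degree 2. Each edge at `c` lies in a triangle, so a neighbour of
    -- `c` sees only `c` and another neighbour of `c`.
    obtain ⟨c, hc⟩ := G.exists_maximal_degree_vertex
    have hmax : ∀ v, G.degree v ≤ G.degree c := fun v => hc ▸ G.degree_le_maxDegree v
    have hdeg : ∀ v, G.Adj c v → G.degree v = 2 := by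
      intro v hv
      have key := fun w hw => hG.connected.two_le_degree_of_notMem_pendantEdges (v := w)
        (by omega) (e := s(c, v)) hv (hP _) hw
      have hc2 := key c (by simp)
      have hv2 := key v (by simp)
      have ht := htight s(c, v) (by simpa using hv)
      rw [edgeBound, if_neg (hP _), edgeWeight_mk] at ht
      have := (eight_le_zagrebWeight (by exact_mod_cast hc2) (by exact_mod_cast hv2)).2.1 ht.symm
      rcases this with h | h
      · have h : G.degree c = 2 := by exact_mod_cast h
        have := hmax v
        omega
      · exact_mod_cast h
    refine ⟨c, hG.connected.isUniversal_of_closed fun v w hcv hvw => ?_⟩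
    obtain ⟨C, hC, hC3, hcC⟩ := hG.card_pendantEdges_add_le.2 heq s(c, v) hcv (hP _)
    obtain ⟨z, hcz, hvz⟩ := exists_adj_adj_of_mem_cycles_of_ncard_eq_three hC hC3 hcC
    have hsub : ({c, z} : Finset V) ⊆ G.neighborFinset v := by
      intro x hx
      rw [Finset.mem_insert, Finset.mem_singleton] at hx
      rw [mem_neighborFinset]
      rcases hx with rfl | rfl
      · exact hcv.symm
      · exact hvz
    have hN := Finset.eq_of_subset_of_card_le hsub
      (by rw [card_neighborFinset_eq_degree, hdeg v hcv, Finset.card_pair hcz.ne])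
    have hw : w ∈ G.neighborFinset v := by simpa using hvw
    rw [← hN, Finset.mem_insert, Finset.mem_singleton] at hw
    rcases hw with rfl | rfl
    · exact .inl rfl
    · exact .inr hcz

/-- In a cactus with a universal vertex every edge is tight. -/
lemma IsCactus.edgeBound_eq_of_isUniversal (hG : G.IsCactus) (hV : 4 ≤ Fintype.card V) {c : V}
    (hc : G.IsUniversal c) : ∀ e ∈ G.edgeFinset, G.edgeBound e = G.edgeWeight e := by
  intro e he
  have hdc := hc.degree_eq
  by_cases h : e ∈ G.pendantEdges
  · obtain ⟨heG, u, ⟨v, rfl⟩, hu⟩ := mem_pendantEdges.1 h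
    have huc : c ≠ u := by
      rintro rfl
      omega
    obtain rfl := eq_of_adj_of_degree_eq_one hu heG (hc huc).symm
    rw [edgeBound, if_pos h, edgeWeight_mk, hu, Nat.cast_one, zagrebWeight_one_left, hdc,
      Nat.cast_sub (by omega), Nat.cast_one]
    ring
  · rw [edgeBound, if_neg h]
    have key := fun v hv => hG.connected.two_le_degree_of_notMem_pendantEdges (v := v) (by omega)
      (by simpa using he) h hv
    induction e with
    | h u v =>
      have hu := key u (by simp)
      have hv := key v (by simp)
      have huv : u ≠ v := by
        rw [mem_edgeFinset] at he
        exact he.ne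
      refine ((eight_le_zagrebWeight (by exact_mod_cast hu) (by exact_mod_cast hv)).2.2 ?_).symm
      by_cases huc : u = c
      · have := hG.degree_le_two_of_isUniversal hc (v := v) (huc ▸ huv.symm)
        exact .inr (by exact_mod_cast le_antisymm this hv)
      · have := hG.degree_le_two_of_isUniversal hc huc
        exact .inl (by exact_mod_cast le_antisymm this hu)

end Bound

end SimpleGraph

theorem theorem1 {V : Type*} [Fintype V] [DecidableEq V] (G : SimpleGraph V)
    [DecidableRel G.Adj] (n k : ℕ) (hn : 4 ≤ n) (hV : Fintype.card V = n)
    (hG : G.IsCactus) (hk : G.cycles.ncard = k) :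
    ((n : ℝ) - 2 * (k : ℝ) - 1) * (((n : ℝ) - 1) / ((n : ℝ) - 2)) ^ 3 + 24 * (k : ℝ)
        ≤ G.augmentedZagreb ∧
      (G.augmentedZagreb =
          ((n : ℝ) - 2 * (k : ℝ) - 1) * (((n : ℝ) - 1) / ((n : ℝ) - 2)) ^ 3 + 24 * (k : ℝ) ↔
        Nonempty (G ≃g SimpleGraph.starWithEdges n k)) := by
  subst hV hk
  have hle := Finset.sum_le_sum (hG.connected.edgeBound_le (by omega))
  have heqiff := Finset.sum_eq_sum_iff_of_le (hG.connected.edgeBound_le (by omega))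
  have hcyc := hG.card_pendantEdges_add_le
  have hedge := hG.card_add_ncard_cycles_le
  rw [SimpleGraph.sum_edgeBound, ← SimpleGraph.augmentedZagreb_eq_sum] at hle heqiff
  have hA := SimpleGraph.star_weight_bounds (n := Fintype.card V) (by exact_mod_cast hn)
  set A : ℝ := (((Fintype.card V : ℝ) - 1) / ((Fintype.card V : ℝ) - 2)) ^ 3
  have h1 : (G.pendantEdges.card : ℝ) + 3 * G.cycles.ncard ≤ G.edgeFinset.card := by
    exact_mod_cast hcyc.1
  have h2 : (Fintype.card V : ℝ) + G.cycles.ncard ≤ G.edgeFinset.card + 1 := by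
    exact_mod_cast hedge
  -- The two slack terms; the bound is linear in these products.
  have h3 := mul_nonneg (sub_nonneg.2 hA.2.le) (sub_nonneg.2 h1)
  have h4 := mul_nonneg hA.1.le (sub_nonneg.2 h2)
  refine ⟨by linarith, fun h => ?_, ?_⟩
  · have h5 : (8 - A) * (G.edgeFinset.card - (G.pendantEdges.card + 3 * G.cycles.ncard)) = 0 := by
      linarith
    have h6 := (mul_eq_zero.1 h5).resolve_left (sub_pos.2 hA.2).ne'
    have h7 : G.pendantEdges.card + 3 * G.cycles.ncard = G.edgeFinset.card := by
      have : (G.pendantEdges.card : ℝ) + 3 * G.cycles.ncard = G.edgeFinset.card := by linarith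
      exact_mod_cast this
    obtain ⟨c, hc⟩ := hG.exists_isUniversal hn h7 (heqiff.1 (by linarith))
    exact hG.nonempty_iso_starWithEdges hc
  · rintro ⟨f⟩
    have hc := (SimpleGraph.starWithEdges_isUniversal (n := Fintype.card V)
      (k := G.cycles.ncard) ⟨0, by omega⟩ rfl).of_iso f
    rw [← heqiff.2 (hG.edgeBound_eq_of_isUniversal hn hc)]
    have h5 := hG.card_edgesAvoiding_eq hc
    have h6 := hc.card_le_card_pendantEdges
    have h7 := G.card_edgesAvoiding_add_degree (f.symm ⟨0, by omega⟩)
    have h8 := hc.degree_eq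
    -- `h6` gives `≥`; `≤` follows from `p + 3k ≤ m` and `m = n - 1 + k`.
    have h9 : G.pendantEdges.card + 2 * G.cycles.ncard + 1 = Fintype.card V := by omega
    have h10 : G.edgeFinset.card = G.pendantEdges.card + 3 * G.cycles.ncard := by omega
    rw [h10, ← h9]
    push_cast
    ring
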